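/- Let $$B=\frac1{\sqrt3}\begin{pmatrix}1&1\\0&1\end{pmatrix},\qquad C=\frac1{\sqrt3}\begin{pmatrix}1&0\\-1&1\end{pmatrix},$$ and let $\rho_0$ be a $2\times2$ density matrix (a positive semidefinite complex matrix with $\mathrm{Tr}\,\rho_0=1$). Consider the open quantum random walk on $\mathbb Z$ generated by $B$ and $C$ and started from $\rho_0\otimes|0\rangle\langle0|$: $\rho^{(0)}_0=\rho_0$, $\rho^{(0)}_x=0$ for $x\ne0$, and $$\rho^{(n+1)}_x=B\rho^{(n)}_{x+1}B^*+C\rho^{(n)}_{x-1}C^*\qquad(x\in\mathbb Z,\ n\ge0).$$ Let $p^{(n)}_x=\mathrm{Tr}\,\rho^{(n)}_x$ be the probability to find the walker at site $x$ at time $n$. For $k\in\mathbb R$ put $$\xi(k)=\left(2\cos k+\sqrt{4\cos^2k+1}\right)^{1/3},\qquad \lambda_1(k)=\frac{2\cos k}3+\frac13\left(\xi(k)-\frac1{\xi(k)}\right),\qquad \alpha_n=\int_{-\pi/2}^{\pi/2}\lambda_1(k)^n\,dk.$$ Then for every $x\in\mathbb Z$ $$\lim_{n\to\infty}\frac{p_x^{(2n)}}{\alpha_{2n}}=\begin{cases}1/\pi,&x\text{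 even},\\0,&x\text{ odd},\end{cases}\qquad \lim_{n\to\infty}\frac{p_x^{(2n-1)}}{\alpha_{2n-1}}=\begin{cases}0,&x\text{ even},\\1/\pi,&x\text{ odd}.\end{cases}$$ -/

import Mathlib

open Filter Topology
open scoped Matrix ComplexOrder

noncomputable section

/-- One step of the open quantum random walk on `ℤ` generated by `B` and `C`.
The block-diagonal state `∑ₓ ρₓ ⊗ |x⟩⟨x|` is represented by its family of blocks `x ↦ ρₓ`. -/
def oqrwStep (B C : Matrix (Fin 2) (Fin 2) ℂ) (ρ : ℤ → Matrix (Fin 2) (Fin 2) ℂ) :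
    ℤ → Matrix (Fin 2) (Fin 2) ℂ :=
  fun x => B * ρ (x + 1) * Bᴴ + C * ρ (x - 1) * Cᴴ

/-- The state at time `n` of the walk started from `ρ₀ ⊗ |0⟩⟨0|`. -/
def oqrwState (B C ρ₀ : Matrix (Fin 2) (Fin 2) ℂ) : ℕ → ℤ → Matrix (Fin 2) (Fin 2) ℂ
  | 0 => fun x => if x = 0 then ρ₀ else 0
  | n + 1 => oqrwStep B C (oqrwState B C ρ₀ n)

/-- The probability `p_x^{(n)} = Tr ρ_x^{(n)}` to find the walker at site `x` at time `n`, as a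
complex number (it is real and nonnegative if `ρ₀` is positive semidefinite). -/
def oqrwProb (B C ρ₀ : Matrix (Fin 2) (Fin 2) ℂ) (n : ℕ) (x : ℤ) : ℂ :=
  (oqrwState B C ρ₀ n x).trace

/-- The generator of left steps. -/
def walkB : Matrix (Fin 2) (Fin 2) ℂ := (1 / (√3 : ℝ) : ℂ) • !![1, 1; 0, 1]

/-- The generator of right steps. -/
def walkC : Matrix (Fin 2) (Fin 2) ℂ := (1 / (√3 : ℝ) : ℂ) • !![1, 0; -1, 1]

/-- `ξ(k) = (2 cos k + √(4 cos² k + 1))^{1/3}`; the base of the power is positive. -/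
def walkXi (k : ℝ) : ℝ := (2 * Real.cos k + √(4 * Real.cos k ^ 2 + 1)) ^ (1 / 3 : ℝ)

/-- `λ₁(k) = (2 cos k) / 3 + (ξ(k) - 1 / ξ(k)) / 3`. -/
def walkLambda (k : ℝ) : ℝ := 2 * Real.cos k / 3 + 1 / 3 * (walkXi k - 1 / walkXi k)

/-- `αₙ = ∫_{-π/2}^{π/2} λ₁(k)ⁿ dk`. -/
def walkAlpha (n : ℕ) : ℝ := ∫ k in (-(Real.pi / 2))..(Real.pi / 2), walkLambda k ^ n

end

/-! Fourier inversion writes `p_x^{(n)}` as `1/π` times the integral over a half period of `e^{-ikx}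
Tr(ρ₀ L_k^n(1))`, with `L_k` the Fourier transformed dual step (`oqrwProb_eq_integral`). By
`oqrwDual_walk_cubic`, the trace satisfies a linear recurrence of order three in `n`, whose
characteristic roots are `λ₁(k)` and a pair with sum `s` and product `p ≤ 2/3`.

Hence the trace is `λ₁(k)^n g(k)` plus a remainder of size `O((2/3)^{n/2})`, uniformly in `k`
(`exists_norm_walkRemainder_le`). On the half period `λ₁` is nonnegative with unique maximum `λ₁(0)
= 1`, so Laplace's method gives the limit `g(0)` for the main term divided by `αₙ`, while `αₙ`
dominates the remainder. Finally `g(0) = 1`, because `L_0` fixes the identity. Sites of the wrong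
parity carry no mass. -/

open MeasureTheory

noncomputable section

/-! ### Duality and Fourier inversion -/

/-- The Fourier transform, at frequency `k`, of the dual (Heisenberg picture) of `oqrwStep B C`. -/
def oqrwDual (B C : Matrix (Fin 2) (Fin 2) ℂ) (k : ℝ) :
    Matrix (Fin 2) (Fin 2) ℂ →ₗ[ℂ] Matrix (Fin 2) (Fin 2) ℂ where
  toFun Y := Complex.exp (-(k * Complex.I)) • (Bᴴ * Y * B) +
    Complex.exp (k * Complex.I) • (Cᴴ * Y * C)
  map_add' Y Z := by
    simp only [mul_add, add_mul, smul_add]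
    abel
  map_smul' a Y := by
    simp only [Matrix.mul_smul, Matrix.smul_mul, RingHom.id_apply, smul_add]
    rw [smul_comm a, smul_comm a]

theorem oqrwDual_apply (B C : Matrix (Fin 2) (Fin 2) ℂ) (k : ℝ) (Y : Matrix (Fin 2) (Fin 2) ℂ) :
    oqrwDual B C k Y = Complex.exp (-(k * Complex.I)) • (Bᴴ * Y * B) +
      Complex.exp (k * Complex.I) • (Cᴴ * Y * C) := rfl

theorem continuous_oqrwDual_pow (B C Y : Matrix (Fin 2) (Fin 2) ℂ) (n : ℕ) :
    Continuous fun k : ℝ => (oqrwDual B C k ^ n) Y := by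
  induction n with
  | zero => simpa using continuous_const
  | succ n ih =>
    simp only [pow_succ', Module.End.mul_apply, oqrwDual_apply]
    fun_prop

theorem oqrwState_eq_zero (B C ρ₀ : Matrix (Fin 2) (Fin 2) ℂ) (n : ℕ) :
    ∀ x : ℤ, ¬ Even ((n : ℤ) - x) → oqrwState B C ρ₀ n x = 0 := by
  induction n with
  | zero =>
    intro x hx
    have : x ≠ 0 := by
      rintro rfl
      simp at hx
    simp [oqrwState, this]
  | succ n ih =>
    intro x hx
    have h1 := ih (x + 1) (by push_cast at hx; grind)
    have h2 := ih (x - 1) (by push_cast at hx; grind)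
    simp [oqrwState, oqrwStep, h1, h2]

/-- Even frequencies are `π`-periodic, so they are orthogonal already on a half period. -/
theorem integral_exp_of_even (x : ℤ) (hx : Even x) :
    ∫ k in (-(Real.pi / 2))..(Real.pi / 2), Complex.exp (-(k * x * Complex.I)) =
      if x = 0 then (Real.pi : ℂ) else 0 := by
  split_ifs with h
  · subst h
    simp
  · have hc : (-(x * Complex.I) : ℂ) ≠ 0 := by simp [h]
    have := integral_exp_mul_complex (a := -(Real.pi / 2)) (b := Real.pi / 2) hc
    have e : ∀ k : ℝ, Complex.exp (-(k * x * Complex.I)) = Complex.exp (-(x * Complex.I) * k) := by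
      intro k
      congr 1
      ring
    simp only [e]
    rw [this]
    obtain ⟨y, rfl⟩ := hx
    have : Complex.exp (-(((y + y : ℤ) : ℂ) * Complex.I) * ((-(Real.pi / 2) : ℝ) : ℂ)) =
        Complex.exp (-(((y + y : ℤ) : ℂ) * Complex.I) * ((Real.pi / 2 : ℝ) : ℂ)) := by
      rw [Complex.exp_eq_exp_iff_exists_int]
      refine ⟨y, ?_⟩
      push_cast
      ring
    rw [this, sub_self, zero_div]

/-- The arbitrary test matrix `Y` makes the induction close: cyclicity of the trace moves the last
step of the walk onto `Y`. -/
theorem pi_mul_trace_oqrwState_mul (B C ρ₀ : Matrix (Fin 2) (Fin 2) ℂ) (n : ℕ) :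
    ∀ (x : ℤ) (Y : Matrix (Fin 2) (Fin 2) ℂ), Even ((n : ℤ) - x) →
      (Real.pi : ℂ) * (oqrwState B C ρ₀ n x * Y).trace =
        ∫ k in (-(Real.pi / 2))..(Real.pi / 2),
          Complex.exp (-(k * x * Complex.I)) * (ρ₀ * (oqrwDual B C k ^ n) Y).trace := by
  induction n with
  | zero =>
    intro x Y hx
    simp only [pow_zero, Module.End.one_apply, intervalIntegral.integral_mul_const]
    rw [integral_exp_of_even x (by simpa using hx)]
    by_cases h : x = 0 <;> simp [oqrwState, h]
  | succ n ih =>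
    intro x Y hx
    have h1 := ih (x + 1) (Bᴴ * Y * B) (by push_cast at hx; grind)
    have h2 := ih (x - 1) (Cᴴ * Y * C) (by push_cast at hx; grind)
    have hcont : ∀ (y : ℤ) (Z : Matrix (Fin 2) (Fin 2) ℂ), Continuous fun k : ℝ =>
        Complex.exp (-(k * y * Complex.I)) * (ρ₀ * (oqrwDual B C k ^ n) Z).trace := by
      intro y Z
      have := continuous_oqrwDual_pow B C Z n
      fun_prop
    have hl : (oqrwState B C ρ₀ (n + 1) x * Y).trace =
        (oqrwState B C ρ₀ n (x + 1) * (Bᴴ * Y * B)).trace +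
          (oqrwState B C ρ₀ n (x - 1) * (Cᴴ * Y * C)).trace := by
      simp only [oqrwState, oqrwStep, add_mul, Matrix.trace_add]
      congr 1
      · rw [← Matrix.mul_assoc, Matrix.trace_mul_comm _ B]
        simp only [Matrix.mul_assoc]
      · rw [← Matrix.mul_assoc, Matrix.trace_mul_comm _ C]
        simp only [Matrix.mul_assoc]
    rw [hl, mul_add, h1, h2, ← intervalIntegral.integral_add
      ((hcont _ _).intervalIntegrable _ _) ((hcont _ _).intervalIntegrable _ _)]
    refine intervalIntegral.integral_congr fun k _ => ?_
    simp only [pow_succ, Module.End.mul_apply, oqrwDual_apply, map_add, map_smul, mul_add,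
      Matrix.mul_smul, Matrix.trace_add, Matrix.trace_smul, smul_eq_mul, ← mul_assoc,
      ← Complex.exp_add]
    congr 3 <;> (push_cast; ring)

/-! ### The cubic relation for the concrete walk -/

theorem oqrwDual_walk (k : ℝ) (a b c d : ℂ) :
    oqrwDual walkB walkC k !![a, b; c, d] = (1 / 3 : ℂ) •
      (Complex.exp (-(k * Complex.I)) • !![a, a + b; a + c, a + b + c + d] +
        Complex.exp (k * Complex.I) • !![a - b - c + d, b - d; c - d, d]) := by
  have h3 : ((√3 : ℝ) : ℂ)⁻¹ * ((√3 : ℝ) : ℂ)⁻¹ = 1 / 3 := by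
    rw [← mul_inv, ← Complex.ofReal_mul, Real.mul_self_sqrt (by norm_num)]
    norm_num
  have hB : walkBᴴ = ((√3 : ℝ) : ℂ)⁻¹ • !![1, 0; 1, 1] := by
    ext i j
    fin_cases i <;> fin_cases j <;> simp [walkB]
  have hC : walkCᴴ = ((√3 : ℝ) : ℂ)⁻¹ • !![1, -1; 0, 1] := by
    ext i j
    fin_cases i <;> fin_cases j <;> simp [walkC]
  rw [oqrwDual_apply, hB, hC, walkB, walkC, one_div]
  simp only [Matrix.smul_mul, Matrix.mul_smul, smul_smul, h3]
  rw [smul_add]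
  simp only [smul_smul]
  congr 1
  · rw [mul_comm (1 / 3 : ℂ)]
    congr 1
    ext i j
    fin_cases i <;> fin_cases j <;> simp <;> ring
  · rw [mul_comm (1 / 3 : ℂ)]
    congr 1
    ext i j
    fin_cases i <;> fin_cases j <;> simp <;> ring

/-- Symmetric matrices form an invariant subspace of dimension three containing `1`; this is
Cayley–Hamilton there. -/
theorem oqrwDual_walk_cubic (k : ℝ) :
    (oqrwDual walkB walkC k ^ 3) 1 = ((2 * Real.cos k : ℝ) : ℂ) • (oqrwDual walkB walkC k ^ 2) 1 -
      ((((2 * Real.cos k) ^ 2 + 1) / 3 : ℝ) : ℂ) • (oqrwDual walkB walkC k) 1 +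
      ((((2 * Real.cos k) ^ 3 + 5 * (2 * Real.cos k)) / 27 : ℝ) : ℂ) • 1 := by
  have hc : 2 * Complex.cos k = Complex.exp (k * Complex.I) + Complex.exp (-(k * Complex.I)) := by
    rw [Complex.cos]
    ring_nf
  have hwz : Complex.exp (k * Complex.I) * Complex.exp (-(k * Complex.I)) = 1 := by
    rw [← Complex.exp_add, add_neg_cancel, Complex.exp_zero]
  push_cast
  rw [hc]
  have key : ∀ a b c d : ℂ, oqrwDual walkB walkC k !![a, b; c, d] =
      !![(Complex.exp (-(k * Complex.I)) * a + Complex.exp (k * Complex.I) * (a - b - c + d)) / 3,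
        (Complex.exp (-(k * Complex.I)) * (a + b) + Complex.exp (k * Complex.I) * (b - d)) / 3;
        (Complex.exp (-(k * Complex.I)) * (a + c) + Complex.exp (k * Complex.I) * (c - d)) / 3,
        (Complex.exp (-(k * Complex.I)) * (a + b + c + d) + Complex.exp (k * Complex.I) * d) / 3] := by
    intro a b c d
    rw [oqrwDual_walk]
    ext i j
    fin_cases i <;> fin_cases j <;> simp <;> ring
  generalize Complex.exp (k * Complex.I) = z at *
  generalize Complex.exp (-(k * Complex.I)) = w at *
  have e3 : (oqrwDual walkB walkC k ^ 3) 1 = oqrwDual walkB walkC k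
    (oqrwDual walkB walkC k (oqrwDual walkB walkC k 1)) := rfl
  have e2 : (oqrwDual walkB walkC k ^ 2) 1 = oqrwDual walkB walkC k
    (oqrwDual walkB walkC k 1) := rfl
  rw [e3, e2, Matrix.one_fin_two]
  simp only [key]
  ext i j
  fin_cases i <;> fin_cases j <;> simp <;> grind

/-! ### The real eigenvalue -/

/-- The real root of `m ^ 3 + 3 * m = 4 * cos k`. -/
def walkRoot (k : ℝ) : ℝ := walkXi k - 1 / walkXi k

theorem walkXi_base_pos (k : ℝ) : 0 < 2 * Real.cos k + √(4 * Real.cos k ^ 2 + 1) := by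
  have h : |2 * Real.cos k| < √(4 * Real.cos k ^ 2 + 1) := by
    apply Real.lt_sqrt_of_sq_lt
    rw [sq_abs]
    nlinarith
  have := neg_abs_le (2 * Real.cos k)
  linarith

theorem walkXi_pos (k : ℝ) : 0 < walkXi k := Real.rpow_pos_of_pos (walkXi_base_pos k) _

theorem walkXi_pow_three (k : ℝ) :
    walkXi k ^ 3 = 2 * Real.cos k + √(4 * Real.cos k ^ 2 + 1) := by
  rw [walkXi, ← Real.rpow_natCast, ← Real.rpow_mul (walkXi_base_pos k).le]
  norm_num

/-- Cardano: with `m = ξ - 1/ξ`, one has `m³ + 3m = ξ³ - ξ⁻³`, and `ξ⁻³ = √(4 cos² k + 1) - 2 cos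
k`. -/
theorem walkRoot_cubic (k : ℝ) : walkRoot k ^ 3 + 3 * walkRoot k = 4 * Real.cos k := by
  have h0 := (walkXi_pos k).ne'
  have h1 : walkRoot k ^ 3 + 3 * walkRoot k = walkXi k ^ 3 - 1 / walkXi k ^ 3 := by
    rw [walkRoot]
    field_simp
    ring
  have h2 := (walkXi_base_pos k).ne'
  rw [h1, walkXi_pow_three]
  have h3 := Real.sq_sqrt (show 0 ≤ 4 * Real.cos k ^ 2 + 1 by positivity)
  rw [sub_eq_iff_eq_add, ← sub_eq_iff_eq_add', eq_div_iff h2]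
  linear_combination h3

theorem continuous_walkXi : Continuous walkXi := by
  unfold walkXi
  exact Continuous.rpow_const (by fun_prop) fun _ => Or.inr (by norm_num)

theorem continuous_walkRoot : Continuous walkRoot := by
  have := continuous_walkXi
  unfold walkRoot
  exact this.sub (continuous_const.div this fun k => (walkXi_pos k).ne')

theorem walkLambda_eq (k : ℝ) : walkLambda k = (2 * Real.cos k + walkRoot k) / 3 := by
  rw [walkLambda, walkRoot]
  ring

theorem continuous_walkLambda : Continuous walkLambda := by
  have := continuous_walkRoot
  simp only [funext walkLambda_eq]
  fun_prop

theorem walkRoot_le_one (k : ℝ) : walkRoot k ≤ 1 := by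
  have h := walkRoot_cubic k
  have := Real.cos_le_one k
  by_contra! hc
  nlinarith [sq_nonneg (walkRoot k), sq_nonneg (walkRoot k - 1)]

theorem walkRoot_nonneg {k : ℝ} (hk : 0 ≤ Real.cos k) : 0 ≤ walkRoot k := by
  have h := walkRoot_cubic k
  by_contra! hc
  nlinarith [sq_nonneg (walkRoot k), mul_pos_of_neg_of_neg hc hc]

theorem walkRoot_zero : walkRoot 0 = 1 := by
  have h := walkRoot_cubic 0
  rw [Real.cos_zero] at h
  have h2 : (walkRoot 0 - 1) * (walkRoot 0 ^ 2 + walkRoot 0 + 4) = 0 := by linear_combination h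
  rcases mul_eq_zero.1 h2 with h3 | h3
  · linarith
  · nlinarith [sq_nonneg (2 * walkRoot 0 + 1)]

theorem walkLambda_zero : walkLambda 0 = 1 := by
  rw [walkLambda_eq, walkRoot_zero, Real.cos_zero]
  norm_num

theorem walkLambda_nonneg {k : ℝ} (hk : 0 ≤ Real.cos k) : 0 ≤ walkLambda k := by
  have := walkRoot_nonneg hk
  rw [walkLambda_eq]
  positivity

theorem walkLambda_lt_one {k : ℝ} (hk : Real.cos k < 1) : walkLambda k < 1 := by
  have := walkRoot_le_one k
  rw [walkLambda_eq]
  linarith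

/-! ### The other two eigenvalues -/

/-- The sum of the two non-real eigenvalues of the Fourier transformed dual walk. -/
def walkSum (k : ℝ) : ℝ := (4 * Real.cos k - walkRoot k) / 3

/-- The product of the two non-real eigenvalues of the Fourier transformed dual walk. -/
def walkProd (k : ℝ) : ℝ :=
  ((2 * Real.cos k) ^ 2 - 2 * Real.cos k * walkRoot k + walkRoot k ^ 2 + 3) / 9

theorem continuous_walkSum : Continuous walkSum := by
  have := continuous_walkRoot
  unfold walkSum
  fun_prop

theorem continuous_walkProd : Continuous walkProd := by
  have := continuous_walkRoot
  unfold walkProd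
  fun_prop

theorem walkProd_le {k : ℝ} (hk : 0 ≤ Real.cos k) : walkProd k ≤ 2 / 3 := by
  have h := walkRoot_cubic k
  have h0 := walkRoot_nonneg hk
  have h1 := walkRoot_le_one k
  have h2 := Real.cos_le_one k
  have h3 : 2 * Real.cos k - walkRoot k ≤ 1 := by
    -- The cubic gives `2 cos k - m = (m³ + m) / 2`, with `0 ≤ m ≤ 1`.
    nlinarith [pow_le_one₀ h0 h1 (n := 3)]
  have h4 : 2 * Real.cos k * (2 * Real.cos k - walkRoot k) ≤ 2 * Real.cos k * 1 := by gcongr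
  have h5 : walkRoot k ^ 2 ≤ 1 := pow_le_one₀ h0 h1
  rw [walkProd]
  linarith

/-- The right side equals `m²/12 + 1/3`. This uniform gap makes the energy of `normSq_recurrence`
control `‖f n‖²`. -/
theorem one_third_le_walkProd_sub (k : ℝ) : 1 / 3 ≤ walkProd k - (walkSum k / 2) ^ 2 := by
  rw [walkProd, walkSum]
  nlinarith [sq_nonneg (walkRoot k)]

theorem walkProd_nonneg (k : ℝ) : 0 ≤ walkProd k := by
  nlinarith [one_third_le_walkProd_sub k, sq_nonneg (walkSum k / 2)]

theorem walk_quadratic_pos (k : ℝ) :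
    0 < walkLambda k ^ 2 - walkSum k * walkLambda k + walkProd k := by
  nlinarith [one_third_le_walkProd_sub k, sq_nonneg (walkLambda k - walkSum k / 2)]

/-- The energy `‖f 1 - (s/2) f 0‖² + (p - s²/4) ‖f 0‖²` of a solution of a linear recurrence
`f (n + 2) = s f (n + 1) - p f n` is multiplied by `p` in each step. -/
theorem normSq_recurrence {f : ℕ → ℂ} {s p : ℝ} (h : ∀ n, f (n + 2) = s * f (n + 1) - p * f n)
    (n : ℕ) :
    Complex.normSq (f (n + 1) - (s / 2 : ℝ) * f n) +
      (p - (s / 2) ^ 2) * Complex.normSq (f n) =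
    p ^ n * (Complex.normSq (f 1 - (s / 2 : ℝ) * f 0) +
      (p - (s / 2) ^ 2) * Complex.normSq (f 0)) := by
  induction n with
  | zero => simp
  | succ n ih =>
    rw [pow_succ' p, mul_assoc, ← ih, h n]
    simp only [Complex.normSq_apply, Complex.sub_re, Complex.sub_im, Complex.mul_re,
      Complex.mul_im, Complex.ofReal_re, Complex.ofReal_im]
    ring

/-! ### Main term and remainder -/

section

variable (ρ₀ : Matrix (Fin 2) (Fin 2) ℂ)

/-- The expected total mass, at frequency `k`, of the walk at time `n`. -/
def walkFourier (k : ℝ) (n : ℕ) : ℂ := (ρ₀ * (oqrwDual walkB walkC k ^ n) 1).trace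

theorem continuous_walkFourier (n : ℕ) : Continuous fun k => walkFourier ρ₀ k n := by
  have := continuous_oqrwDual_pow walkB walkC 1 n
  unfold walkFourier
  fun_prop

theorem walkFourier_cubic (k : ℝ) (n : ℕ) :
    walkFourier ρ₀ k (n + 3) = ((2 * Real.cos k : ℝ) : ℂ) * walkFourier ρ₀ k (n + 2) -
      ((((2 * Real.cos k) ^ 2 + 1) / 3 : ℝ) : ℂ) * walkFourier ρ₀ k (n + 1) +
      ((((2 * Real.cos k) ^ 3 + 5 * (2 * Real.cos k)) / 27 : ℝ) : ℂ) * walkFourier ρ₀ k n := by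
  simp only [walkFourier, pow_add _ n, Module.End.mul_apply, oqrwDual_walk_cubic, map_add, map_sub,
    map_smul, mul_add, mul_sub, Matrix.mul_smul, Matrix.trace_add, Matrix.trace_sub,
    Matrix.trace_smul, smul_eq_mul, pow_one]

/-- The component of the Fourier transformed walk along the real eigenvalue, unnormalised. -/
def walkNumer (k : ℝ) : ℂ :=
  walkFourier ρ₀ k 2 - walkSum k * walkFourier ρ₀ k 1 + walkProd k * walkFourier ρ₀ k 0

/-- The cubic factors as `(X - λ₁)(X² - sX + p)`; applying the quadratic factor leaves a geometric
sequence of ratio `λ₁`. -/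
theorem walkFourier_quadratic (k : ℝ) (n : ℕ) :
    walkFourier ρ₀ k (n + 2) - walkSum k * walkFourier ρ₀ k (n + 1) +
      walkProd k * walkFourier ρ₀ k n = walkLambda k ^ n * walkNumer ρ₀ k := by
  induction n with
  | zero => simp [walkNumer]
  | succ n ih =>
    rw [pow_succ', mul_assoc, ← ih, walkFourier_cubic ρ₀ k n]
    have h := walkRoot_cubic k
    have e1 : (2 * Real.cos k) = walkLambda k + walkSum k := by
      rw [walkLambda_eq, walkSum]
      ring
    have e2 : ((2 * Real.cos k) ^ 2 + 1) / 3 = walkLambda k * walkSum k + walkProd k := by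
      rw [walkLambda_eq, walkSum, walkProd]
      ring
    have e3 : ((2 * Real.cos k) ^ 3 + 5 * (2 * Real.cos k)) / 27 = walkLambda k * walkProd k := by
      rw [walkLambda_eq, walkProd]
      linear_combination -h / 27
    rw [e2, e3, e1]
    push_cast
    ring

/-- The component of the Fourier transformed walk along the real eigenvalue. -/
def walkCoeff (k : ℝ) : ℂ :=
  walkNumer ρ₀ k / ((walkLambda k ^ 2 - walkSum k * walkLambda k + walkProd k : ℝ) : ℂ)

theorem continuous_walkCoeff : Continuous (walkCoeff ρ₀) := by
  have h0 := continuous_walkFourier ρ₀ 0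
  have h1 := continuous_walkFourier ρ₀ 1
  have h2 := continuous_walkFourier ρ₀ 2
  have hs := continuous_walkSum
  have hp := continuous_walkProd
  have hl := continuous_walkLambda
  unfold walkCoeff walkNumer
  refine Continuous.div ((h2.sub ((Complex.continuous_ofReal.comp hs).mul h1)).add
    ((Complex.continuous_ofReal.comp hp).mul h0)) (Complex.continuous_ofReal.comp
      (((hl.pow 2).sub (hs.mul hl)).add hp)) fun k => ?_
  exact_mod_cast (walk_quadratic_pos k).ne'

theorem walkFourier_zero (htr : ρ₀.trace = 1) (n : ℕ) : walkFourier ρ₀ 0 n = 1 := by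
  have h : oqrwDual walkB walkC 0 1 = 1 := by
    rw [Matrix.one_fin_two, oqrwDual_walk]
    ext i j
    fin_cases i <;> fin_cases j <;> simp <;> norm_num
  have : (oqrwDual walkB walkC 0 ^ n) 1 = 1 := by
    induction n with
    | zero => simp
    | succ n ih => rw [pow_succ, Module.End.mul_apply, h, ih]
  rw [walkFourier, this, mul_one, htr]

theorem walkCoeff_zero (htr : ρ₀.trace = 1) : walkCoeff ρ₀ 0 = 1 := by
  have h : ((walkLambda 0 ^ 2 - walkSum 0 * walkLambda 0 + walkProd 0 : ℝ) : ℂ) ≠ 0 := by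
    exact_mod_cast (walk_quadratic_pos 0).ne'
  rw [walkCoeff, div_eq_one_iff_eq h, walkNumer]
  simp [walkFourier_zero ρ₀ htr, walkLambda_zero]

/-- The part of the Fourier transformed walk that is exponentially smaller than the main term. -/
def walkRemainder (k : ℝ) (n : ℕ) : ℂ :=
  walkFourier ρ₀ k n - walkLambda k ^ n * walkCoeff ρ₀ k

theorem continuous_walkRemainder (n : ℕ) : Continuous fun k => walkRemainder ρ₀ k n := by
  have h0 := continuous_walkFourier ρ₀ n
  have h1 := continuous_walkCoeff ρ₀
  have hl := continuous_walkLambda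
  unfold walkRemainder
  fun_prop

theorem walkRemainder_recurrence (k : ℝ) (n : ℕ) :
    walkRemainder ρ₀ k (n + 2) =
      walkSum k * walkRemainder ρ₀ k (n + 1) - walkProd k * walkRemainder ρ₀ k n := by
  have h := walkFourier_quadratic ρ₀ k n
  have hq : ((walkLambda k ^ 2 - walkSum k * walkLambda k + walkProd k : ℝ) : ℂ) ≠ 0 := by
    exact_mod_cast (walk_quadratic_pos k).ne'
  have hg : walkCoeff ρ₀ k *
      ((walkLambda k ^ 2 - walkSum k * walkLambda k + walkProd k : ℝ) : ℂ) = walkNumer ρ₀ k :=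
    div_mul_cancel₀ _ hq
  rw [← hg] at h
  push_cast at h
  simp only [walkRemainder]
  linear_combination h

theorem cos_nonneg_of_mem_Icc_half_pi {k : ℝ}
    (hk : k ∈ Set.Icc (-(Real.pi / 2)) (Real.pi / 2)) : 0 ≤ Real.cos k :=
  Real.cos_nonneg_of_mem_Icc hk

theorem exists_norm_walkRemainder_le : ∃ K : ℝ, 0 ≤ K ∧ ∀ n : ℕ,
    ∀ k ∈ Set.Icc (-(Real.pi / 2)) (Real.pi / 2),
      ‖walkRemainder ρ₀ k n‖ ≤ K * √(2 / 3) ^ n := by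
  let Q : ℝ → ℝ := fun k => Complex.normSq (walkRemainder ρ₀ k 1 -
    (walkSum k / 2 : ℝ) * walkRemainder ρ₀ k 0) +
    (walkProd k - (walkSum k / 2) ^ 2) * Complex.normSq (walkRemainder ρ₀ k 0)
  have hQ : Continuous Q := by
    have h0 := continuous_walkRemainder ρ₀ 0
    have h1 := continuous_walkRemainder ρ₀ 1
    have hs := continuous_walkSum
    have hp := continuous_walkProd
    have := Complex.continuous_normSq
    fun_prop
  obtain ⟨A, hA⟩ := (isCompact_Icc (a := -(Real.pi / 2)) (b := Real.pi / 2)).bddAbove_image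
    hQ.continuousOn
  have hA' : ∀ k ∈ Set.Icc (-(Real.pi / 2)) (Real.pi / 2), Q k ≤ A := fun k hk =>
    hA (Set.mem_image_of_mem _ hk)
  -- The initial energy is at most `A`, and the factor `3` inverts the gap `1/3`.
  refine ⟨√(3 * A), Real.sqrt_nonneg _, fun n k hk => ?_⟩
  have hcos := cos_nonneg_of_mem_Icc_half_pi hk
  have hd := one_third_le_walkProd_sub k
  have hE := normSq_recurrence (walkRemainder_recurrence ρ₀ k) n
  have hQ0 : 0 ≤ Q k := add_nonneg (Complex.normSq_nonneg _)
    (mul_nonneg (by linarith) (Complex.normSq_nonneg _))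
  have h1 : walkProd k ^ n * Q k ≤ (2 / 3) ^ n * A :=
    mul_le_mul (pow_le_pow_left₀ (walkProd_nonneg k) (walkProd_le hcos) n) (hA' k hk) hQ0
      (by positivity)
  have h2 := Complex.normSq_nonneg (walkRemainder ρ₀ k (n + 1) -
    (walkSum k / 2 : ℝ) * walkRemainder ρ₀ k n)
  have h3 := mul_le_mul_of_nonneg_right hd (Complex.normSq_nonneg (walkRemainder ρ₀ k n))
  have h4 : Complex.normSq (walkRemainder ρ₀ k n) ≤ 3 * A * (2 / 3) ^ n := by
    change _ = walkProd k ^ n * Q k at hE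
    linarith
  rw [Complex.normSq_eq_norm_sq] at h4
  have hA0 : 0 ≤ A := hQ0.trans (hA' k hk)
  refine abs_le_of_sq_le_sq' ?_ (by positivity) |>.2
  rw [mul_pow, Real.sq_sqrt (by positivity), ← pow_mul, mul_comm n 2, pow_mul,
    Real.sq_sqrt (by norm_num)]
  exact h4

/-! ### Laplace's method and the limits -/

/-- Since `λ₁(0) = 1`, any rate below `1` would do; `9/10` is chosen to exceed `√(2/3)`. -/
theorem exists_le_walkAlpha : ∃ ε : ℝ, 0 < ε ∧ ∀ n : ℕ, ε * (9 / 10) ^ n ≤ walkAlpha n := by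
  have hpi := Real.pi_pos
  have hev : ∀ᶠ k in 𝓝 (0 : ℝ), 9 / 10 < walkLambda k :=
    continuous_walkLambda.continuousAt.eventually (lt_mem_nhds (by rw [walkLambda_zero]; norm_num))
  obtain ⟨δ, hδ, hb⟩ := Metric.eventually_nhds_iff.1 hev
  set ε := min (δ / 2) (Real.pi / 2) with hε
  have hε0 : 0 < ε := by positivity
  have hεδ : ε < δ := (min_le_left _ _).trans_lt (by linarith)
  have hεπ : ε ≤ Real.pi / 2 := min_le_right _ _
  refine ⟨ε, hε0, fun n => ?_⟩
  have hint : ∀ a b : ℝ, IntervalIntegrable (fun k => walkLambda k ^ n) volume a b := fun a b =>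
    (continuous_walkLambda.pow n).intervalIntegrable a b
  calc ε * (9 / 10) ^ n = ∫ _ in (0 : ℝ)..ε, (9 / 10 : ℝ) ^ n := by simp
    _ ≤ ∫ k in (0 : ℝ)..ε, walkLambda k ^ n := by
      refine intervalIntegral.integral_mono_on hε0.le (by simp) (hint _ _) fun k hk => ?_
      refine pow_le_pow_left₀ (by norm_num) (hb ?_).le n
      rw [Real.dist_eq, sub_zero, abs_of_nonneg hk.1]
      linarith [hk.2]
    _ ≤ walkAlpha n := by
      refine intervalIntegral.integral_mono_interval (by linarith) hε0.le hεπ ?_ (hint _ _)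
      filter_upwards [ae_restrict_mem measurableSet_Ioc] with k hk
      exact pow_nonneg (walkLambda_nonneg
        (cos_nonneg_of_mem_Icc_half_pi (Set.Ioc_subset_Icc_self hk))) n

theorem walkAlpha_pos (n : ℕ) : 0 < walkAlpha n := by
  obtain ⟨ε, hε, h⟩ := exists_le_walkAlpha
  exact lt_of_lt_of_le (by positivity) (h n)

/-- The weights `λ₁^n / αₙ` concentrate at the unique maximum `k = 0`. -/
theorem tendsto_integral_walkLambda_pow_mul {g : ℝ → ℂ} (hg : Continuous g) :
    Tendsto (fun n : ℕ => (∫ k in (-(Real.pi / 2))..(Real.pi / 2), walkLambda k ^ n * g k) /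
      (walkAlpha n : ℂ)) atTop (𝓝 (g 0)) := by
  have hpi := Real.pi_pos
  have h := tendsto_setIntegral_pow_smul_of_unique_maximum_of_isCompact_of_continuousOn
    (μ := volume) (s := Set.Icc (-(Real.pi / 2)) (Real.pi / 2)) isCompact_Icc
    (c := walkLambda) (g := g) (x₀ := 0) continuous_walkLambda.continuousOn
    (fun k hk hne => by
      rw [walkLambda_zero]
      refine walkLambda_lt_one ((Real.cos_le_one k).lt_of_ne fun h1 => hne ?_)
      exact (Real.cos_eq_one_iff_of_lt_of_lt (by linarith [hk.1]) (by linarith [hk.2])).1 h1)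
    (fun k hk => walkLambda_nonneg (cos_nonneg_of_mem_Icc_half_pi hk))
    (by rw [walkLambda_zero]; norm_num)
    (by
      rw [interior_Icc, closure_Ioo (by linarith)]
      exact ⟨by linarith, by linarith⟩)
    hg.continuousOn
  refine h.congr fun n => ?_
  rw [walkAlpha, intervalIntegral.integral_of_le (by linarith),
    intervalIntegral.integral_of_le (by linarith), integral_Icc_eq_integral_Ioc,
    integral_Icc_eq_integral_Ioc, Complex.real_smul]
  simp only [Complex.real_smul, Complex.ofReal_inv, Complex.ofReal_pow]
  exact (div_eq_inv_mul _ _).symm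

theorem tendsto_integral_walkRemainder (x : ℤ) :
    Tendsto (fun n : ℕ => (∫ k in (-(Real.pi / 2))..(Real.pi / 2),
      Complex.exp (-(k * x * Complex.I)) * walkRemainder ρ₀ k n) / (walkAlpha n : ℂ))
      atTop (𝓝 0) := by
  have hpi := Real.pi_pos
  obtain ⟨ε, hε, hα⟩ := exists_le_walkAlpha
  obtain ⟨K, hK, hb⟩ := exists_norm_walkRemainder_le ρ₀
  have hr : √(2 / 3) / (9 / 10) < 1 := by
    rw [div_lt_one (by norm_num), Real.sqrt_lt' (by norm_num)]
    norm_num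
  have hlim : Tendsto (fun n : ℕ => K * Real.pi / ε * (√(2 / 3) / (9 / 10)) ^ n) atTop (𝓝 0) := by
    simpa using (tendsto_pow_atTop_nhds_zero_of_lt_one (by positivity) hr).const_mul
      (K * Real.pi / ε)
  refine squeeze_zero_norm (fun n => ?_) hlim
  have hi : ‖∫ k in (-(Real.pi / 2))..(Real.pi / 2),
      Complex.exp (-(k * x * Complex.I)) * walkRemainder ρ₀ k n‖ ≤ K * √(2 / 3) ^ n * Real.pi := by
    refine (intervalIntegral.norm_integral_le_of_norm_le_const (C := K * √(2 / 3) ^ n)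
      fun k hk => ?_).trans_eq ?_
    · rw [Set.uIoc_of_le (by linarith)] at hk
      have he : Complex.exp (-(k * x * Complex.I)) =
          Complex.exp ((-(k * x) : ℝ) * Complex.I) := by
        push_cast
        ring_nf
      rw [norm_mul, he, Complex.norm_exp_ofReal_mul_I, one_mul]
      exact hb n k (Set.Ioc_subset_Icc_self hk)
    · rw [sub_neg_eq_add, add_halves, abs_of_pos hpi]
  rw [norm_div, Complex.norm_real, Real.norm_eq_abs, abs_of_pos (walkAlpha_pos n)]
  calc _ ≤ K * √(2 / 3) ^ n * Real.pi / (ε * (9 / 10) ^ n) := by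
        gcongr
        exact hα n
    _ = _ := by
        rw [div_pow √(2 / 3), div_mul_div_comm]
        ring

theorem tendsto_integral_walkFourier (htr : ρ₀.trace = 1) (x : ℤ) :
    Tendsto (fun n : ℕ => (∫ k in (-(Real.pi / 2))..(Real.pi / 2),
      Complex.exp (-(k * x * Complex.I)) * walkFourier ρ₀ k n) / (walkAlpha n : ℂ))
      atTop (𝓝 1) := by
  have hg : Continuous fun k : ℝ => Complex.exp (-(k * x * Complex.I)) * walkCoeff ρ₀ k := by
    have := continuous_walkCoeff ρ₀
    fun_prop
  have h := (tendsto_integral_walkLambda_pow_mul hg).add (tendsto_integral_walkRemainder ρ₀ x)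
  simp only [walkCoeff_zero ρ₀ htr, Complex.ofReal_zero, zero_mul, neg_zero, Complex.exp_zero,
    mul_one, add_zero] at h
  refine h.congr fun n => ?_
  have hl := continuous_walkLambda
  have hr := continuous_walkRemainder ρ₀ n
  rw [← add_div, ← intervalIntegral.integral_add
    (Continuous.intervalIntegrable (by fun_prop) _ _)
    (Continuous.intervalIntegrable (by fun_prop) _ _)]
  congr 1
  refine intervalIntegral.integral_congr fun k _ => ?_
  simp only [walkRemainder]
  ring

theorem oqrwProb_eq_integral {n : ℕ} {x : ℤ} (h : Even ((n : ℤ) - x)) :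
    oqrwProb walkB walkC ρ₀ n x = 1 / (Real.pi : ℂ) *
      ∫ k in (-(Real.pi / 2))..(Real.pi / 2),
        Complex.exp (-(k * x * Complex.I)) * walkFourier ρ₀ k n := by
  have hpi : (Real.pi : ℂ) ≠ 0 := by exact_mod_cast Real.pi_ne_zero
  have := pi_mul_trace_oqrwState_mul walkB walkC ρ₀ n x 1 h
  rw [mul_one] at this
  rw [oqrwProb, eq_comm, one_div, inv_mul_eq_iff_eq_mul₀ hpi, this]
  rfl

theorem tendsto_oqrwProb_div_walkAlpha (htr : ρ₀.trace = 1) (x : ℤ) {φ : ℕ → ℕ}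
    (hφ : Tendsto φ atTop atTop) (h : ∀ᶠ n in atTop, Even ((φ n : ℤ) - x)) :
    Tendsto (fun n : ℕ => oqrwProb walkB walkC ρ₀ (φ n) x / (walkAlpha (φ n) : ℂ))
      atTop (𝓝 (1 / (Real.pi : ℂ))) := by
  have := ((tendsto_integral_walkFourier ρ₀ htr x).comp hφ).const_mul (1 / (Real.pi : ℂ))
  rw [mul_one] at this
  refine this.congr' ?_
  filter_upwards [h] with n hn
  rw [oqrwProb_eq_integral ρ₀ hn, mul_div_assoc]
  rfl

theorem tendsto_oqrwProb_div_walkAlpha_zero (x : ℤ) {φ : ℕ → ℕ}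
    (h : ∀ᶠ n in atTop, ¬ Even ((φ n : ℤ) - x)) :
    Tendsto (fun n : ℕ => oqrwProb walkB walkC ρ₀ (φ n) x / (walkAlpha (φ n) : ℂ))
      atTop (𝓝 0) := by
  refine tendsto_const_nhds.congr' ?_
  filter_upwards [h] with n hn
  rw [oqrwProb, oqrwState_eq_zero _ _ _ _ _ hn, Matrix.trace_zero, zero_div]

end

end

theorem theorem4 (ρ₀ : Matrix (Fin 2) (Fin 2) ℂ) (hpos : ρ₀.PosSemidef) (htr : ρ₀.trace = 1)
    (x : ℤ) :
    (Even x →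
      Tendsto (fun n : ℕ => oqrwProb walkB walkC ρ₀ (2 * n) x / (walkAlpha (2 * n) : ℂ))
        atTop (𝓝 (1 / (Real.pi : ℂ))) ∧
      Tendsto (fun n : ℕ => oqrwProb walkB walkC ρ₀ (2 * n - 1) x / (walkAlpha (2 * n - 1) : ℂ))
        atTop (𝓝 0)) ∧
    (Odd x →
      Tendsto (fun n : ℕ => oqrwProb walkB walkC ρ₀ (2 * n) x / (walkAlpha (2 * n) : ℂ))
        atTop (𝓝 0) ∧
      Tendsto (fun n : ℕ => oqrwProb walkB walkC ρ₀ (2 * n - 1) x / (walkAlpha (2 * n - 1) : ℂ))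
        atTop (𝓝 (1 / (Real.pi : ℂ)))) := by
  have he : Tendsto (fun n : ℕ => 2 * n) atTop atTop :=
    tendsto_atTop_mono (fun n => show n ≤ 2 * n by omega) tendsto_id
  have ho : Tendsto (fun n : ℕ => 2 * n - 1) atTop atTop :=
    -- Truncated subtraction makes `2 * n - 1` even at `n = 0`, so odd times are treated only for `n
    -- ≥ 1`.
    tendsto_atTop_mono' _ ((eventually_ge_atTop 1).mono fun n hn => show n ≤ 2 * n - 1 by omega)
      tendsto_id
  refine ⟨fun hx => ⟨?_, ?_⟩, fun hx => ⟨?_, ?_⟩⟩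
  · refine tendsto_oqrwProb_div_walkAlpha ρ₀ htr x he (Eventually.of_forall fun n => ?_)
    rw [Int.even_iff] at *
    omega
  · refine tendsto_oqrwProb_div_walkAlpha_zero ρ₀ x ((eventually_ge_atTop 1).mono fun n hn => ?_)
    rw [Int.even_iff] at *
    omega
  · refine tendsto_oqrwProb_div_walkAlpha_zero ρ₀ x (Eventually.of_forall fun n => ?_)
    rw [Int.even_iff]
    rw [Int.odd_iff] at hx
    omega
  · refine tendsto_oqrwProb_div_walkAlpha ρ₀ htr x ho ((eventually_ge_atTop 1).mono fun n hn => ?_)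
    rw [Int.even_iff]
    rw [Int.odd_iff] at hx
    omega
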